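/- Let $G$ be a finite group. For a ring $R$ write $\zeta(R)$ for its centre. Decompose $\mathbb{Q}[G]=\bigoplus_{i=1}^t A_i$ into simple algebras $A_i = \mathbb{Q}[G]e_i$, where $e_1,\dots,e_t$ are the central primitive idempotents, and put $F_i=\zeta(A_i)$. For $n\in\mathbb{N}$ let $\mathrm{nr}\colon M_n(\mathbb{Q}[G])\to\zeta(\mathbb{Q}[G])=\bigoplus_{i=1}^t F_i$ be the reduced norm, i.e. the map which is given on each component by the reduced norm of the central simple $F_i$-algebra $M_n(A_i)$ (the determinant after an extension of scalars to a splitting field of this algebra). The integrality ring of $G$ is $$\mathcal{I}(G)=\big\langle\, \mathrm{nr}(H) \;\big|\; n\in\mathbb{N},\ H\in M_n(\mathbb{Z}[G])\,\big\rangle_{\zeta(\mathbb{Z}[G])}\subseteq\zeta(\mathbb{Q}[G]),$$ the $\zeta(\mathbb{Z}[G])$-submodule of $\zeta(\mathbb{Q}[G])$ generated by the reduced norms of all square matrices with entries in $\mathbb{Z}[G]$. Then: 1. $\mathcal{I}(G)=\zeta(\mathbb{Z}[G])$ if and only if $G$ is abelian. 2. If $G$ is not abelian, then there is an element $x\in\mathbb{Z}[G]$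 such that $\mathrm{nr}(x)\notin\mathbb{Z}[G]$. -/

import Mathlib

open scoped TensorProduct

universe u

/-- `r` is a value at `b` of the reduced norm of the central simple `K`-algebra `B`:
for a splitting field `E` of `B`, i.e. a field extension `E` of `K` together with an isomorphism
`h : E ⊗[K] B ≃ M_m(E)` of `E`-algebras, it is the determinant of `h (1 ⊗ b)`.
(`K` is a field in all cases of interest; it is only required to be a commutative ring here in order
that the definition applies literally to the centre of a simple ring.) -/
def IsReducedNormCSA (K B : Type u) [CommRing K] [Ring B] [Algebra K B] (b : B) (r : K) : Prop :=
  ∃ (E : Type u) (_ : Field E) (_ : Algebra K E) (m : ℕ)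
    (h : (E ⊗[K] B) ≃ₐ[E] Matrix (Fin m) (Fin m) E),
    (h (1 ⊗ₜ[K] b)).det = algebraMap K E r

open Classical in
/-- The reduced norm `B → K` of a central simple `K`-algebra `B`. By the classical theory the value
`r` exists and does not depend on the splitting field or on the isomorphism. -/
noncomputable def reducedNormCSA (K : Type u) {B : Type u} [CommRing K] [Ring B] [Algebra K B]
    (b : B) : K :=
  if h : ∃ r : K, IsReducedNormCSA K B b r then h.choose else 0

/-- Central primitive idempotents of a ring. -/
structure IsCentralPrimitiveIdempotent {A : Type u} [Ring A] (e : A) : Prop where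
  idem : IsIdempotentElem e
  central : e ∈ Subring.center A
  ne_zero : e ≠ 0
  primitive : ∀ f ∈ Subring.center A, IsIdempotentElem f → e * f = f → f = 0 ∨ f = e

namespace IsCentralPrimitiveIdempotent

variable {A : Type u} [Ring A] {e : A} (he : IsCentralPrimitiveIdempotent e)

/-- The component `A e = e A e` of `A`, a ring with identity `e`. -/
abbrev Component : Type u := he.idem.Corner

/-- The projection `a ↦ e a e = a e` of `A` onto the component `A e`. -/
def proj (a : A) : he.Component := ⟨e * a * e, a, rfl⟩

/-- The centre of the component `A e` is contained in the centre of `A`. -/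
def centerIncl (z : Subring.center he.Component) : Subring.center A :=
  ⟨(z : he.Component).1, by
    obtain ⟨⟨y, hy⟩, hz⟩ := z
    have hy' := (Subsemigroup.mem_corner_iff he.idem).mp hy
    have hc := Subring.mem_center_iff.mp he.central
    refine Subring.mem_center_iff.mpr fun a => ?_
    have h1 : e * a * e * y = y * (e * a * e) :=
      congrArg Subtype.val (Subring.mem_center_iff.mp hz ⟨e * a * e, a, rfl⟩)
    have h2 : e * a * e * y = a * y := by
      rw [mul_assoc, hy'.1, ← hc a, mul_assoc, hy'.1]
    have h3 : y * (e * a * e) = y * a := by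
      rw [mul_assoc, hc a, ← mul_assoc e e a, he.idem.eq, ← mul_assoc, hy'.2]
    change a * y = y * a
    rw [← h2, h1, h3]⟩

end IsCentralPrimitiveIdempotent

/-- The reduced norm `nr : M_n(A) → ζ(A)` for a finite dimensional separable algebra `A` over a field
(the field itself does not enter). It is defined componentwise: `A` is the direct
product of its simple components `A e`, where `e` runs over the central primitive idempotents,
`M_n(A e)` is a central simple algebra over the centre of `A e`, and `ζ(A)` is the direct product of
these centres. -/
noncomputable def nr {A : Type u} [Ring A] {n : ℕ} (H : Matrix (Fin n) (Fin n) A) :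
    Subring.center A :=
  ∑ᶠ e : {e : A // IsCentralPrimitiveIdempotent e},
    e.2.centerIncl (reducedNormCSA (Subring.center e.2.Component) (H.map e.2.proj))

/-- The centre `ζ(Λ)` of a subring `Λ` of `A`, as a subring of `A`. -/
def centreOf {A : Type u} [Ring A] (L : Subring A) : Subring A :=
  (Subring.center L).map L.subtype

/-- The integrality ring `I(Λ)`: the `ζ(Λ)`-submodule generated by the reduced norms of
all square matrices with entries in `Λ`. It lies in `ζ(A)`, and here it is
regarded as a submodule of `A`. -/
noncomputable def integralityRing {A : Type u} [Ring A] (L : Subring A) :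
    Submodule (centreOf L) A :=
  Submodule.span (centreOf L)
    {z | ∃ (n : ℕ) (H : Matrix (Fin n) (Fin n) A), (∀ i j, H i j ∈ L) ∧ z = (nr H : A)}

/-- The integral group ring `ℤ[G]`, as a subring of `ℚ[G]`. -/
noncomputable def integralGroupRing (G : Type u) [Group G] : Subring (MonoidAlgebra ℚ G) :=
  (MonoidAlgebra.mapRingHom G (Int.castRingHom ℚ)).range

open scoped commutatorElement

/-! Only two values of the reduced norm are needed: the determinant on a commutative component, and
0 at a zero divisor. In the abelian case this makes `nr` a determinant. For nonabelian `G`, suppose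
`nr` preserves `ℤ[G]`, and take `N` maximal among the normal subgroups not containing `G'`. If `H >
N` has normal closure `M`, then `G' ≤ M`. Components on which `H` acts trivially are commutative,
and on the others the sum of `H` is a zero divisor. So the reduced norm of that sum is `|H|/|M|`
times the sum of `M`, and integrality forces `H = M` (`eq_normalClosure_of_nr_mem`). Hence in `Q =
G/N` every nontrivial subgroup contains `Q'`, and some conjugacy class is a coset `Q'g`. For a lift
`g` and `x = g · ΣN`, the central, `N`-invariant element `nr x` is constant on `Mg`, where now `M =
NG'`. On the components where `M` acts trivially `nr x` agrees with `x`, so its coefficient at `g`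
is `|N|/|M|`. Integrality gives `N = M ≥ G'`, a contradiction. -/

/-! ### Reduced norms over a field: split algebras and zero divisors -/

/-- Skolem–Noether: after a dimension count, the isomorphism is conjugation by a linear
automorphism. -/
theorem det_eq_det_of_algEquiv {E : Type u} [Field E] {n m : ℕ}
    (f : Matrix (Fin n) (Fin n) E ≃ₐ[E] Matrix (Fin m) (Fin m) E) (M : Matrix (Fin n) (Fin n) E) :
    (f M).det = M.det := by
  obtain rfl : n = m := by
    have := f.toLinearEquiv.finrank_eq
    simp only [Module.finrank_matrix, Fintype.card_fin, Module.finrank_self, mul_one] at this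
    exact Nat.mul_self_inj.mp this
  let t : Matrix (Fin n) (Fin n) E ≃ₐ[E] Module.End E (Fin n → E) := Matrix.toLinAlgEquiv'
  obtain ⟨T, hT⟩ := (t.symm.trans (f.trans t)).eq_linearEquivConjAlgEquiv
  have h1 : t (f M) = T.conjAlgEquiv E (t M) := by
    rw [← hT]; simp
  have h2 : ∀ X, LinearMap.det (t X) = X.det := fun X => LinearMap.det_toLin' X
  rw [← h2, ← h2, h1]
  exact LinearMap.det_conj (t M) T

theorem isReducedNormCSA_iff {K B : Type u} [Field K] [Ring B] [Algebra K B] {n : ℕ}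
    (f : B ≃ₐ[K] Matrix (Fin n) (Fin n) K) (b : B) (r : K) :
    IsReducedNormCSA K B b r ↔ r = (f b).det := by
  constructor
  · rintro ⟨E, _, _, m, h, hr⟩
    apply (algebraMap K E).injective
    let t : E ⊗[K] Matrix (Fin n) (Fin n) K ≃ₐ[E] Matrix (Fin n) (Fin n) E :=
      AlgEquiv.ofRingEquiv (f := (matrixEquivTensor (Fin n) K E).symm.toRingEquiv) fun x => by
        simp [Algebra.TensorProduct.algebraMap_apply, Matrix.smul_one_eq_diagonal,
          Matrix.algebraMap_eq_diagonal, Pi.algebraMap_def]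
    let g : E ⊗[K] B ≃ₐ[E] Matrix (Fin n) (Fin n) E :=
      (Algebra.TensorProduct.congr AlgEquiv.refl f).trans t
    have hg : g (1 ⊗ₜ b) = (algebraMap K E).mapMatrix (f b) := by
      simp [g, t]
    rw [← hr, RingHom.map_det, ← hg, ← det_eq_det_of_algEquiv (g.symm.trans h)]
    simp
  · rintro rfl
    refine ⟨K, inferInstance, inferInstance, n, (Algebra.TensorProduct.lid K B).trans f, ?_⟩
    simp

theorem reducedNormCSA_eq_det {K B : Type u} [CommRing K] [Ring B] [Algebra K B] (hK : IsField K)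
    {n : ℕ} (f : B ≃ₐ[K] Matrix (Fin n) (Fin n) K) (b : B) :
    reducedNormCSA K b = (f b).det := by
  let _ := hK.toField
  have h : ∃ r : K, IsReducedNormCSA K B b r := ⟨_, (isReducedNormCSA_iff f b _).2 rfl⟩
  rw [reducedNormCSA, dif_pos h]
  exact (isReducedNormCSA_iff f b _).1 h.choose_spec

/-- A zero divisor stays one after scalar extension, so its determinant vanishes. If no value
exists, the default is also 0, so existence of reduced norms is never needed. -/
theorem reducedNormCSA_eq_zero {K B : Type u} [CommRing K] [Ring B] [Algebra K B] (hK : IsField K)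
    {b c : B} (hc : c ≠ 0) (hbc : b * c = 0) : reducedNormCSA K b = 0 := by
  let _ := hK.toField
  rw [reducedNormCSA]
  split_ifs with h
  · obtain ⟨E, _, _, m, f, hf⟩ := h.choose_spec
    by_contra hr
    have hu : IsUnit (f (1 ⊗ₜ[K] b)) := by
      rw [Matrix.isUnit_iff_isUnit_det, hf]
      exact (IsUnit.mk0 _ hr).map _
    have h0 : f (1 ⊗ₜ[K] b) * f (1 ⊗ₜ[K] c) = 0 := by
      rw [← map_mul, Algebra.TensorProduct.tmul_mul_tmul, hbc]; simp
    have h1 : (1 : E) ⊗ₜ[K] c = 0 := by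
      simpa using (hu.mul_right_eq_zero.1 h0)
    exact hc (Algebra.TensorProduct.includeRight_injective (R := K) (A := E) (B := B)
      (algebraMap K E).injective (by simpa using h1))
  · rfl

/-! ### The centre as a product of fields, and its primitive idempotents -/

/-- By semisimplicity the left ideal of `z` is generated by an idempotent `a * z`, whose square is 0
because `z` is central. -/
theorem eq_zero_of_mem_center_of_sq_eq_zero {A : Type u} [Ring A] [IsSemisimpleRing A]
    {z : A} (hz : z ∈ Subring.center A) (h : z * z = 0) :
    z = 0 := by
  obtain ⟨f, hf, hs⟩ := IsSemisimpleRing.ideal_eq_span_idempotent (Ideal.span {z})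
  have h1 : f ∈ Ideal.span {z} := hs ▸ Ideal.mem_span_singleton_self f
  have h2 : z ∈ Ideal.span {f} := hs ▸ Ideal.mem_span_singleton_self z
  obtain ⟨a, rfl⟩ := Ideal.mem_span_singleton'.1 h1
  obtain ⟨b, hb⟩ := Ideal.mem_span_singleton'.1 h2
  rw [← hb, ← hf.eq]
  have : a * z * (a * z) = 0 := by
    rw [mul_assoc, ← mul_assoc z, ← Subring.mem_center_iff.1 hz a, mul_assoc, h]; simp
  rw [this, mul_zero]

instance isReduced_center {A : Type u} [Ring A] [Algebra ℚ A] [IsSemisimpleRing A] :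
     IsReduced (Subalgebra.center ℚ A) := by
  rw [isReduced_iff_pow_one_lt 2 one_lt_two]
  rintro ⟨z, hz⟩ h
  exact Subtype.ext (eq_zero_of_mem_center_of_sq_eq_zero hz (by
    simpa [pow_two] using congrArg Subtype.val h))

instance isArtinianRing_center {A : Type u} [Ring A] [Algebra ℚ A] [FiniteDimensional ℚ A] :
     IsArtinianRing (Subalgebra.center ℚ A) :=
  IsArtinianRing.of_finite ℚ _

theorem exists_mul_mul_eq_of_mem_center {A : Type u} [Ring A] [Algebra ℚ A] [FiniteDimensional ℚ A]
    [IsSemisimpleRing A] {z : A} (hz : z ∈ Subring.center A) :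
    ∃ w ∈ Subring.center A, z * w * z = z := by
  classical
  let φ := IsArtinianRing.equivPi (Subalgebra.center ℚ A)
  let _ : ∀ I : MaximalSpectrum (Subalgebra.center ℚ A), Field (_ ⧸ I.asIdeal) :=
    fun I => Ideal.Quotient.field I.asIdeal
  -- Componentwise inverse in the product of fields, with `0⁻¹ = 0`.
  let w := φ.symm fun I => (φ ⟨z, hz⟩ I)⁻¹
  refine ⟨w, w.2, congrArg Subtype.val
    (?_ : (⟨z, hz⟩ : Subalgebra.center ℚ A) * w * ⟨z, hz⟩ = ⟨z, hz⟩)⟩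
  apply φ.injective
  ext I
  simp only [map_mul, w, AlgEquiv.apply_symm_apply, Pi.mul_apply]
  by_cases h : φ ⟨z, hz⟩ I = 0
  · simp [h]
  · rw [mul_inv_cancel₀ h, one_mul]

namespace IsCentralPrimitiveIdempotent

theorem mul_eq_zero_or {A : Type u} [Ring A] {e f : A} (he : IsCentralPrimitiveIdempotent e)
    (hf : f ∈ Subring.center A) (hi : IsIdempotentElem f) : e * f = 0 ∨ e * f = e :=
  he.primitive _ (Subring.mul_mem _ he.central hf)
    (he.idem.mul_of_commute (Subring.mem_center_iff.1 hf e) hi) (by rw [← mul_assoc, he.idem.eq])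

theorem mul_eq_zero {A : Type u} [Ring A] {e f : A} (he : IsCentralPrimitiveIdempotent e)
    (hf : IsCentralPrimitiveIdempotent f) (h : e ≠ f) : e * f = 0 := by
  refine (he.mul_eq_zero_or hf.central hf.idem).resolve_right fun h1 => ?_
  rcases hf.mul_eq_zero_or he.central he.idem with h2 | h2
  · rw [Subring.mem_center_iff.1 he.central f, h1] at h2
    exact he.ne_zero h2
  · rw [Subring.mem_center_iff.1 he.central f, h1] at h2
    exact h h2

end IsCentralPrimitiveIdempotent

/-- The unit vectors of the product of fields are primitive and sum to 1; any other primitive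
idempotent would be orthogonal to all of them, hence 0. -/
theorem exists_complete_centralPrimitiveIdempotents {A : Type u} [Ring A] [Algebra ℚ A]
    [FiniteDimensional ℚ A] [IsSemisimpleRing A] :
    Finite {e : A // IsCentralPrimitiveIdempotent e} ∧
      ∑ᶠ e : {e : A // IsCentralPrimitiveIdempotent e}, (e : A) = 1 := by
  classical
  let C := Subalgebra.center ℚ A
  let φ := IsArtinianRing.equivPi C
  let _ : ∀ I : MaximalSpectrum C, Field (C ⧸ I.asIdeal) :=
    fun I => Ideal.Quotient.field I.asIdeal
  let ε : MaximalSpectrum C → C := fun I => φ.symm (Pi.single I 1)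
  have hε : ∀ I, IsCentralPrimitiveIdempotent (ε I : A) := fun I => by
    refine ⟨?_, (ε I).2, ?_, fun f hf hi h => ?_⟩
    · refine congrArg Subtype.val (?_ : ε I * ε I = ε I)
      rw [← map_mul, ← Pi.single_mul, one_mul]
    · intro h
      have : ε I = 0 := Subtype.ext h
      rw [map_eq_zero_iff _ φ.symm.injective] at this
      exact one_ne_zero (α := C ⧸ I.asIdeal) (by simpa using congrFun this I)
    · let f' : C := ⟨f, hf⟩
      have hi' : φ f' I * φ f' I = φ f' I := by
        rw [← Pi.mul_apply, ← map_mul]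
        exact congrArg (fun x => φ x I) (Subtype.ext hi.eq)
      have h' : φ f' = Pi.single I (φ f' I) := by
        have : ε I * f' = f' := Subtype.ext h
        apply_fun φ at this
        rw [map_mul, AlgEquiv.apply_symm_apply] at this
        rw [← this]
        ext J
        rcases eq_or_ne J I with rfl | hJ
        · simp
        · simp [hJ]
      rcases IsIdempotentElem.iff_eq_zero_or_one.1 hi' with h0 | h1
      · left
        rw [h0, Pi.single_zero, map_eq_zero_iff _ φ.injective] at h'
        exact congrArg Subtype.val h'
      · right
        rw [h1] at h'
        exact congrArg Subtype.val ((φ.symm_apply_eq.2 h'.symm).symm : f' = ε I)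
  have := Fintype.ofFinite (MaximalSpectrum C)
  have hsum : ∑ I, (ε I : A) = 1 := by
    have : ∑ I, ε I = 1 := by
      rw [← map_sum, Finset.univ_sum_single (fun _ => 1)]
      exact map_one φ.symm
    simpa using congrArg Subtype.val this
  let F : MaximalSpectrum C → {e : A // IsCentralPrimitiveIdempotent e} := fun I => ⟨ε I, hε I⟩
  have hF : Function.Bijective F := by
    constructor
    · intro I J h
      by_contra hIJ
      have h1 : ε I = ε J := Subtype.ext (congrArg (fun x => x.1) h :)
      have h2 := congrFun (φ.symm.injective h1) I
      simp [hIJ] at h2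
    · rintro ⟨e, he⟩
      by_contra hne
      apply he.ne_zero
      rw [← mul_one e, ← hsum, Finset.mul_sum]
      exact Finset.sum_eq_zero fun I _ => he.mul_eq_zero (hε I) fun h =>
        hne ⟨I, Subtype.ext h.symm⟩
  have := Finite.of_surjective F hF.2
  refine ⟨this, ?_⟩
  rw [← hsum, ← finsum_eq_sum_of_fintype]
  exact (finsum_eq_of_bijective F hF fun _ => rfl).symm


/-! ### Components and their centres -/

namespace IsCentralPrimitiveIdempotent

theorem proj_mul {A : Type u} [Ring A] {e : A} (he : IsCentralPrimitiveIdempotent e) (a b : A) :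
    he.proj (a * b) = he.proj a * he.proj b := by
  have hc := Subring.mem_center_iff.1 he.central
  refine Subtype.ext (?_ : e * (a * b) * e = e * a * e * (e * b * e))
  simp only [mul_assoc, ← mul_assoc e e, he.idem.eq]
  rw [← mul_assoc a e, hc a, mul_assoc e a, ← mul_assoc e e, he.idem.eq]

theorem proj_val {A : Type u} [Ring A] {e : A} (he : IsCentralPrimitiveIdempotent e)
    (y : he.Component) : he.proj y.1 = y := by
  have hy := (Subsemigroup.mem_corner_iff he.idem).mp y.2
  exact Subtype.ext ((congrArg (· * e) hy.1).trans hy.2)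

theorem proj_coe {A : Type u} [Ring A] {e : A} (he : IsCentralPrimitiveIdempotent e)
    (a : A) : (he.proj a).1 = e * a := by
  change e * a * e = e * a
  rw [mul_assoc, Subring.mem_center_iff.1 he.central a, ← mul_assoc, he.idem.eq]

/-- The ring homomorphism from the centre of `A` to the centre of a component. -/
def projCenter {A : Type u} [Ring A] {e : A} (he : IsCentralPrimitiveIdempotent e) :
    Subring.center A →+* Subring.center he.Component where
  toFun c := ⟨he.proj c, Subring.mem_center_iff.2 fun y => by
    rw [← he.proj_val y, ← proj_mul, ← proj_mul, Subring.mem_center_iff.1 c.2]⟩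
  map_one' := Subtype.ext <| Subtype.ext <| by
    simp only [proj_coe, OneMemClass.coe_one, mul_one]; rfl
  map_mul' a b := Subtype.ext (he.proj_mul a b)
  map_zero' := Subtype.ext <| Subtype.ext <| by
    simp only [proj_coe, ZeroMemClass.coe_zero, mul_zero]; rfl
  map_add' a b := Subtype.ext <| Subtype.ext <| by
    change (he.proj (a + b)).1 = (he.proj a).1 + (he.proj b).1
    simp only [proj_coe, mul_add]

theorem centerIncl_projCenter {A : Type u} [Ring A] {e : A} (he : IsCentralPrimitiveIdempotent e)
    (c : Subring.center A) : (he.centerIncl (he.projCenter c) : A) = e * c :=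
  he.proj_coe c

theorem projCenter_centerIncl {A : Type u} [Ring A] {e : A} (he : IsCentralPrimitiveIdempotent e)
    (z : Subring.center he.Component) : he.projCenter (he.centerIncl z) = z :=
  Subtype.ext (he.proj_val z.1)

theorem mul_centerIncl {A : Type u} [Ring A] {e : A} (he : IsCentralPrimitiveIdempotent e)
    (z : Subring.center he.Component) : e * (he.centerIncl z : A) = he.centerIncl z := by
  rw [← he.centerIncl_projCenter, he.projCenter_centerIncl]

theorem isField_center {A : Type u} [Ring A] [Algebra ℚ A] [FiniteDimensional ℚ A]
    [IsSemisimpleRing A] {e : A} (he : IsCentralPrimitiveIdempotent e) :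
    IsField (Subring.center he.Component) where
  exists_pair_ne := ⟨0, 1, fun h => he.ne_zero
    (congrArg (fun z : Subring.center he.Component => z.1.1) h).symm⟩
  mul_comm := mul_comm
  mul_inv_cancel {z} hz := by
    obtain ⟨w, hw, h⟩ := exists_mul_mul_eq_of_mem_center (he.centerIncl z).2
    have hz' := he.mul_centerIncl z
    refine ⟨he.projCenter ⟨w, hw⟩, ?_⟩
    -- If `z * w * z = z`, then `z * w` is an idempotent below `e`, hence 0 or `e`.
    rcases he.primitive ((he.centerIncl z : A) * w) (Subring.mul_mem _ (he.centerIncl z).2 hw)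
      (by rw [IsIdempotentElem, ← mul_assoc, h]) (by rw [← mul_assoc, hz']) with h0 | h1
    · refine absurd ?_ hz
      rw [h0, zero_mul] at h
      rw [← he.projCenter_centerIncl z, (Subtype.ext h.symm : he.centerIncl z = 0), map_zero]
    · have h2 : he.centerIncl z * ⟨w, hw⟩ = he.centerIncl 1 := Subtype.ext h1
      simpa only [map_mul, projCenter_centerIncl] using congrArg he.projCenter h2

/-- A commutative component is its own centre, so its matrix algebra is already split. -/
theorem reducedNormCSA_map_proj_eq_det {A : Type u} [Ring A] [Algebra ℚ A] [FiniteDimensional ℚ A]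
    [IsSemisimpleRing A] {e : A} (he : IsCentralPrimitiveIdempotent e)
    (hcomm : ∀ x y : he.Component, x * y = y * x) {n : ℕ} (H : Matrix (Fin n) (Fin n) A)
    (H' : Matrix (Fin n) (Fin n) (Subring.center he.Component))
    (hH : ∀ i j, (H' i j : he.Component) = he.proj (H i j)) :
    reducedNormCSA (Subring.center he.Component) (H.map he.proj) = H'.det := by
  let f : Subring.center he.Component ≃ₐ[Subring.center he.Component] he.Component :=
    AlgEquiv.ofBijective (Algebra.ofId _ _)
      ⟨Subtype.val_injective, fun y => ⟨⟨y, Subring.mem_center_iff.2 fun x => hcomm x y⟩, rfl⟩⟩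
  rw [reducedNormCSA_eq_det he.isField_center f.symm.mapMatrix]
  congr 1
  ext i j : 1
  simp only [AlgEquiv.mapMatrix_apply, Matrix.map_apply]
  rw [AlgEquiv.symm_apply_eq]
  exact (hH i j).symm

end IsCentralPrimitiveIdempotent

/-! ### Componentwise computation of `nr` -/

theorem mul_nr {A : Type u} [Ring A] [Algebra ℚ A] [FiniteDimensional ℚ A]
    [IsSemisimpleRing A] {e : A} (he : IsCentralPrimitiveIdempotent e) {n : ℕ}
    (H : Matrix (Fin n) (Fin n) A) :
    e * (nr H : A) =
      he.centerIncl (reducedNormCSA (Subring.center he.Component) (H.map he.proj)) := by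
  have := (exists_complete_centralPrimitiveIdempotents (A := A)).1
  have := Fintype.ofFinite {e : A // IsCentralPrimitiveIdempotent e}
  rw [nr, finsum_eq_sum_of_fintype, AddSubmonoidClass.coe_finsetSum, Finset.mul_sum,
    Finset.sum_eq_single ⟨e, he⟩]
  · exact he.mul_centerIncl _
  · intro f _ hf
    rw [← f.2.mul_centerIncl, ← mul_assoc, he.mul_eq_zero f.2 (fun h => hf (Subtype.ext h.symm)),
      zero_mul]
  · simp

theorem eq_of_forall_mul_eq {A : Type u} [Ring A] [Algebra ℚ A] [FiniteDimensional ℚ A]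
    [IsSemisimpleRing A] {a b : A}
    (h : ∀ e : A, IsCentralPrimitiveIdempotent e → e * a = e * b) : a = b := by
  obtain ⟨_, hs⟩ := exists_complete_centralPrimitiveIdempotents (A := A)
  have := Fintype.ofFinite {e : A // IsCentralPrimitiveIdempotent e}
  rw [finsum_eq_sum_of_fintype] at hs
  rw [← one_mul a, ← one_mul b, ← hs, Finset.sum_mul, Finset.sum_mul]
  exact Finset.sum_congr rfl fun e _ => h e e.2

theorem mul_nr_of_commute {A : Type u} [Ring A] [Algebra ℚ A] [FiniteDimensional ℚ A]
    [IsSemisimpleRing A] {e : A} (he : IsCentralPrimitiveIdempotent e)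
    (hcomm : ∀ a b : A, e * (a * b) = e * (b * a)) (x : A) :
    e * (nr !![x] : A) = e * x := by
  have hc : ∀ x y : he.Component, x * y = y * x := fun x y => by
    rw [← he.proj_val x, ← he.proj_val y, ← he.proj_mul, ← he.proj_mul]
    exact Subtype.ext (by rw [he.proj_coe, he.proj_coe, hcomm])
  rw [mul_nr he, he.reducedNormCSA_map_proj_eq_det hc _
    !![⟨he.proj x, Subring.mem_center_iff.2 fun y => hc y _⟩] (fun i j => by
      fin_cases i; fin_cases j; rfl), Matrix.det_fin_one]
  exact he.proj_coe x

theorem mul_nr_eq_zero {A : Type u} [Ring A] [Algebra ℚ A] [FiniteDimensional ℚ A]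
    [IsSemisimpleRing A] {e : A} (he : IsCentralPrimitiveIdempotent e) {x y : A}
    (hxy : e * (x * y) = 0) (hy : e * y ≠ 0) : e * (nr !![x] : A) = 0 := by
  rw [mul_nr he, reducedNormCSA_eq_zero he.isField_center (c := !![he.proj y])]
  · rfl
  · intro h
    apply hy
    rw [← he.proj_coe]
    exact congrArg Subtype.val (congrFun (congrFun h 0) 0)
  · ext i j : 2
    fin_cases i; fin_cases j
    simp [Matrix.mul_apply, ← he.proj_mul]
    exact Subtype.ext ((he.proj_coe _).trans hxy)

theorem nr_eq_det {A : Type u} [Ring A] [Algebra ℚ A] [FiniteDimensional ℚ A]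
    [IsSemisimpleRing A] (hcomm : ∀ a b : A, a * b = b * a) {n : ℕ}
    (H : Matrix (Fin n) (Fin n) (Subring.center A)) :
    nr (H.map Subtype.val) = H.det := by
  refine Subtype.ext (eq_of_forall_mul_eq fun e he => ?_)
  have hc : ∀ x y : he.Component, x * y = y * x := fun x y => Subtype.ext (hcomm x.1 y.1)
  rw [mul_nr he, he.reducedNormCSA_map_proj_eq_det hc (H.map Subtype.val)
    (he.projCenter.mapMatrix H) (fun i j => rfl), ← RingHom.map_det, he.centerIncl_projCenter]

/-! ### A conjugacy class that is a coset of the commutator subgroup -/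

/-- If every nontrivial subgroup of a nonabelian group contains the commutator subgroup, then some
conjugacy class is a coset of the commutator subgroup. -/
theorem exists_forall_mem_commutator_isConj {Q : Type*} [Group Q]
    (hne : ¬ ∀ a b : Q, a * b = b * a)
    (hQ : ∀ K : Subgroup Q, K ≠ ⊥ → commutator Q ≤ K) :
    ∃ g : Q, ∀ z ∈ commutator Q, ∃ k : Q, k * g * k⁻¹ = z * g := by
  push Not at hne
  obtain ⟨a, b, hab⟩ := hne
  have hcen : ∀ z ∈ commutator Q, ∀ h : Q, h * z = z * h := by
    intro z hz h
    by_cases h1 : h = 1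
    · simp [h1]
    -- The commutator subgroup lies in the cyclic group generated by `h`, so it commutes with `h`.
    · obtain ⟨i, rfl⟩ := Subgroup.mem_zpowers_iff.1
        (hQ (Subgroup.zpowers h) (by simpa using h1) hz)
      exact ((Commute.refl h).zpow_right i).eq
  have hmem : ∀ x y : Q, ⁅x, y⁆ ∈ commutator Q := fun x y =>
    Subgroup.commutator_mem_commutator (Subgroup.mem_top x) (Subgroup.mem_top y)
  -- Centrality of commutators makes `k ↦ ⁅k, a⁆` a homomorphism; its nontrivial image contains the
  -- commutator subgroup.
  let φ : Q →* Q :=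
    { toFun := fun k => ⁅k, a⁆
      map_one' := commutatorElement_one_left a
      map_mul' := fun k l => by
        have h1 : ⁅k * l, a⁆ = k * ⁅l, a⁆ * k⁻¹ * ⁅k, a⁆ := by
          simp only [commutatorElement_def]; group
        rw [h1, hcen _ (hmem l a) k, mul_inv_cancel_right, hcen _ (hmem k a)] }
  refine ⟨a, fun z hz => ?_⟩
  have hφ : φ.range ≠ ⊥ := fun h => hab <| by
    have hb : φ b ∈ φ.range := ⟨b, rfl⟩
    rw [h, Subgroup.mem_bot] at hb
    exact (commutatorElement_eq_one_iff_mul_comm.1 hb).symm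
  obtain ⟨k, hk⟩ := hQ φ.range hφ hz
  exact ⟨k, by simp [← hk, φ, commutatorElement_def]⟩

/-! ### Subgroup sums and their action on components -/

section

variable {G : Type u} [Group G] [Finite G]

/-- The sum of the elements of a subgroup, in the rational group ring. -/
noncomputable def subgroupSum {G : Type u} [Group G] [Finite G] (H : Subgroup G) :
    MonoidAlgebra ℚ G :=
  MonoidAlgebra.ofCoeff (Finsupp.equivFunOnFinite.symm ((H : Set G).indicator 1))

open MonoidAlgebra

theorem coeff_subgroupSum (H : Subgroup G) (g : G) :
    (subgroupSum H).coeff g = (H : Set G).indicator 1 g := rfl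

theorem mem_integralGroupRing_iff {G : Type u} [Group G] {x : MonoidAlgebra ℚ G} :
    x ∈ integralGroupRing G ↔ ∀ g, ∃ n : ℤ, x.coeff g = n := by
  constructor
  · rintro ⟨y, rfl⟩ g
    exact ⟨y.coeff g, by simp⟩
  · intro h
    choose f hf using h
    classical
    rw [← x.sum_coeff_single]
    refine Subring.sum_mem _ fun g _ => ⟨single g (f g), ?_⟩
    simp [hf]

theorem single_mem_integralGroupRing {G : Type u} [Group G] (g : G) :
    single g 1 ∈ integralGroupRing G := ⟨single g 1, by simp⟩

theorem subgroupSum_mem_integralGroupRing (H : Subgroup G) :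
    subgroupSum H ∈ integralGroupRing G := by
  classical
  refine mem_integralGroupRing_iff.2 fun g => ⟨if g ∈ H then 1 else 0, ?_⟩
  simp [coeff_subgroupSum, Set.indicator_apply]

theorem subgroupSum_mul_single {H : Subgroup G} {h : G} (hh : h ∈ H) :
    subgroupSum H * single h 1 = subgroupSum H := by
  classical
  ext g
  simp [coeff_subgroupSum, Set.indicator_apply, H.mul_mem_cancel_right (H.inv_mem hh)]

theorem subgroupSum_eq_sum (H : Subgroup G) [Fintype H] :
    subgroupSum H = ∑ h : H, single (h : G) 1 := by
  classical
  ext g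
  simp only [coeff_subgroupSum, Set.indicator_apply, coeff_sum, Finset.sum_apply',
    coeff_single, Finsupp.single_apply, SetLike.mem_coe, Pi.one_apply]
  split_ifs with h
  · rw [Finset.sum_eq_single ⟨g, h⟩] <;> aesop
  · rw [Finset.sum_eq_zero]
    aesop

theorem mul_subgroupSum_eq_of_forall {H : Subgroup G} {x : MonoidAlgebra ℚ G}
    (hx : ∀ h ∈ H, x * single h 1 = x) : x * subgroupSum H = (Nat.card H : ℚ) • x := by
  have := Fintype.ofFinite H
  rw [subgroupSum_eq_sum, Finset.mul_sum, Finset.sum_congr rfl fun (h : H) _ => hx h h.2]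
  simp [← Nat.cast_smul_eq_nsmul ℚ]

theorem mem_center_iff_forall_single {G : Type u} [Group G] {x : MonoidAlgebra ℚ G} :
    x ∈ Subring.center (MonoidAlgebra ℚ G) ↔ ∀ g, single g 1 * x = x * single g 1 := by
  rw [Subring.mem_center_iff]
  refine ⟨fun h g => h _, fun h y => ?_⟩
  rw [← y.sum_coeff_single, Finsupp.sum, Finset.sum_mul, Finset.mul_sum]
  refine Finset.sum_congr rfl fun g _ => ?_
  have : single g (y.coeff g) = y.coeff g • single g (1 : ℚ) := by simp
  rw [this, smul_mul_assoc, h, mul_smul_comm]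

theorem subgroupSum_mem_center (M : Subgroup G) [hM : M.Normal] :
    subgroupSum M ∈ Subring.center (MonoidAlgebra ℚ G) := by
  classical
  refine mem_center_iff_forall_single.2 fun g => ?_
  ext k
  simp [coeff_subgroupSum, Set.indicator_apply, hM.mem_comm_iff (a := k)]

/-- The kernel of the action of a group on a component of its rational group ring. -/
def actionKernel {G : Type u} [Group G] {e : MonoidAlgebra ℚ G}
    (_he : IsCentralPrimitiveIdempotent e) : Subgroup G where
  carrier := {g | e * single g 1 = e}
  one_mem' := by simp [← one_def]
  mul_mem' {a b} ha hb := by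
    have : single (a * b) (1 : ℚ) = single a 1 * single b 1 := by simp
    rw [Set.mem_ofPred_eq, this, ← mul_assoc, ha, hb]
  inv_mem' {a} ha := by
    have : single a (1 : ℚ) * single a⁻¹ 1 = 1 := by simp [one_def]
    rw [Set.mem_ofPred_eq] at ha ⊢
    nth_rw 1 [← ha]
    rw [mul_assoc, this, mul_one]

theorem mem_actionKernel {G : Type u} [Group G] {e : MonoidAlgebra ℚ G}
    (he : IsCentralPrimitiveIdempotent e) {g : G} :
    g ∈ actionKernel he ↔ e * single g 1 = e := Iff.rfl

instance actionKernel_normal {G : Type u} [Group G] {e : MonoidAlgebra ℚ G}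
    (he : IsCentralPrimitiveIdempotent e) :
    (actionKernel he).Normal where
  conj_mem n hn g := by
    rw [mem_actionKernel] at hn ⊢
    have h1 : single (g * n * g⁻¹) (1 : ℚ) = single g 1 * single n 1 * single g⁻¹ 1 := by simp
    have h2 : single g (1 : ℚ) * single g⁻¹ 1 = 1 := by simp [one_def]
    rw [h1, ← mul_assoc, ← mul_assoc, ← Subring.mem_center_iff.1 he.central, mul_assoc _ e, hn,
      Subring.mem_center_iff.1 he.central, mul_assoc, h2, mul_one]

theorem mul_subgroupSum_of_le_actionKernel {e : MonoidAlgebra ℚ G}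
    (he : IsCentralPrimitiveIdempotent e) {H : Subgroup G} (hH : H ≤ actionKernel he) :
    e * subgroupSum H = (Nat.card H : ℚ) • e :=
  mul_subgroupSum_eq_of_forall fun _ h => hH h

theorem card_ne_zero_rat (H : Subgroup G) : (Nat.card H : ℚ) ≠ 0 :=
  Nat.cast_ne_zero.2 Nat.card_pos.ne'

/-- The average over `M` is a central idempotent, so it acts on the component as 0 or as 1; in the
second case `M` acts trivially. -/
theorem mul_subgroupSum_eq_zero_or {e : MonoidAlgebra ℚ G}
    (he : IsCentralPrimitiveIdempotent e) (M : Subgroup G) [M.Normal] :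
    e * subgroupSum M = 0 ∨ M ≤ actionKernel he := by
  have hc := card_ne_zero_rat M
  have hss : subgroupSum M * subgroupSum M = (Nat.card M : ℚ) • subgroupSum M :=
    mul_subgroupSum_eq_of_forall fun _ h => subgroupSum_mul_single h
  rcases he.mul_eq_zero_or (f := (Nat.card M : ℚ)⁻¹ • subgroupSum M)
    (Subalgebra.smul_mem (Subalgebra.center ℚ _) (subgroupSum_mem_center M) _)
    (by rw [IsIdempotentElem, smul_mul_smul_comm, hss, smul_smul, mul_assoc, inv_mul_cancel₀ hc,
          mul_one]) with h | h
  · left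
    rw [mul_smul_comm, smul_eq_zero] at h
    exact h.resolve_left (inv_ne_zero hc)
  · right
    intro m hm
    rw [mem_actionKernel]
    nth_rw 1 [← h]
    rw [mul_assoc, smul_mul_assoc, subgroupSum_mul_single hm, h]

theorem mul_mul_comm_of_commutator_le {G : Type u} [Group G] {e : MonoidAlgebra ℚ G}
    (he : IsCentralPrimitiveIdempotent e) (hc : commutator G ≤ actionKernel he)
    (a b : MonoidAlgebra ℚ G) : e * (a * b) = e * (b * a) := by
  have key : ∀ g h : G, e * (single g 1 * single h 1) = e * (single h 1 * single g 1) := by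
    intro g h
    have h1 : single g (1 : ℚ) * single h 1 = single ⁅g, h⁆ 1 * (single h 1 * single g 1) := by
      simp [commutatorElement_def]
    rw [h1, ← mul_assoc, (mem_actionKernel he).1 (hc (Subgroup.commutator_mem_commutator
      (Subgroup.mem_top g) (Subgroup.mem_top h)))]
  have hs : ∀ (g : G) (r : ℚ), single g r = r • single g (1 : ℚ) := fun g r => by simp
  rw [← a.sum_coeff_single, ← b.sum_coeff_single, Finsupp.sum, Finsupp.sum,
    Finset.sum_mul_sum, Finset.sum_mul_sum, Finset.mul_sum, Finset.mul_sum]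
  simp only [Finset.mul_sum]
  rw [Finset.sum_comm]
  refine Finset.sum_congr rfl fun h _ => Finset.sum_congr rfl fun g _ => ?_
  rw [hs g, hs h]
  simp only [smul_mul_assoc, mul_smul_comm, key g h]
  rw [smul_comm]

theorem mul_left_comm_of_mem_center {A : Type*} [Ring A] {e : A} (he : e ∈ Subring.center A)
    (a b : A) : e * (a * b) = a * (e * b) := by
  rw [← mul_assoc, ← mul_assoc, Subring.mem_center_iff.1 he]

/-! ### Reduced norms of elements built from subgroup sums -/

/-- The sum of `M` kills every component except those where `M`, hence `G'`, acts trivially; these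
are commutative. -/
theorem subgroupSum_mul_nr (M : Subgroup G) [M.Normal] (hM : commutator G ≤ M)
    (x : MonoidAlgebra ℚ G) :
    subgroupSum M * (nr !![x] : MonoidAlgebra ℚ G) = subgroupSum M * x := by
  refine eq_of_forall_mul_eq fun e he => ?_
  rcases mul_subgroupSum_eq_zero_or he M with h | h
  · rw [← mul_assoc, ← mul_assoc, h, zero_mul, zero_mul]
  · rw [mul_left_comm_of_mem_center he.central, mul_left_comm_of_mem_center he.central,
      mul_nr_of_commute he (mul_mul_comm_of_commutator_le he (hM.trans h))]

theorem card_smul_nr_subgroupSum (H : Subgroup G)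
    (hM : commutator G ≤ Subgroup.normalClosure (H : Set G)) :
    (Nat.card (Subgroup.normalClosure (H : Set G)) : ℚ) •
      (nr !![subgroupSum H] : MonoidAlgebra ℚ G) =
    (Nat.card H : ℚ) • subgroupSum (Subgroup.normalClosure (H : Set G)) := by
  refine eq_of_forall_mul_eq fun e he => ?_
  rw [mul_smul_comm, mul_smul_comm]
  by_cases hH : H ≤ actionKernel he
  · have h := Subgroup.normalClosure_le_normal (N := actionKernel he) hH
    rw [mul_nr_of_commute he (mul_mul_comm_of_commutator_le he (hM.trans h)),
      mul_subgroupSum_of_le_actionKernel he hH, mul_subgroupSum_of_le_actionKernel he h,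
      smul_comm]
  · rw [(mul_subgroupSum_eq_zero_or he _).resolve_right fun h =>
      hH (le_trans Subgroup.le_normalClosure h)]
    obtain ⟨h, hh, hne⟩ := SetLike.not_le_iff_exists.1 hH
    -- Some `h ∈ H` acts nontrivially, and `1 - h` is then a nonzero annihilator of the sum of `H`
    -- in this component.
    rw [mul_nr_eq_zero he (y := 1 - single h 1), smul_zero, smul_zero]
    · rw [mul_sub, subgroupSum_mul_single hh, mul_one, sub_self, mul_zero]
    · rw [mul_sub, mul_one, sub_ne_zero]
      exact fun h => hne h.symm

/-- Encodes right `N`-invariance of the reduced norm: it vanishes on components where `N` acts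
nontrivially. -/
theorem nr_mul_subgroupSum_mul (N : Subgroup G) [N.Normal] (x : MonoidAlgebra ℚ G) :
    (nr !![x * subgroupSum N] : MonoidAlgebra ℚ G) * subgroupSum N =
      (Nat.card N : ℚ) • (nr !![x * subgroupSum N] : MonoidAlgebra ℚ G) := by
  refine eq_of_forall_mul_eq fun e he => ?_
  rw [mul_left_comm_of_mem_center he.central, mul_smul_comm]
  rcases mul_subgroupSum_eq_zero_or he N with h | h
  · rw [h, mul_nr_eq_zero he (y := 1), mul_zero, smul_zero]
    · rw [mul_one, mul_left_comm_of_mem_center he.central, h, mul_zero]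
    · rw [mul_one]; exact he.ne_zero
  · rw [mul_subgroupSum_of_le_actionKernel he h, mul_smul_comm,
      Subring.mem_center_iff.1 he.central]

theorem eq_normalClosure_of_nr_mem (H : Subgroup G)
    (hM : commutator G ≤ Subgroup.normalClosure (H : Set G))
    (hH : (nr !![subgroupSum H] : MonoidAlgebra ℚ G) ∈ integralGroupRing G) :
    H = Subgroup.normalClosure (H : Set G) := by
  obtain ⟨n, hn⟩ := mem_integralGroupRing_iff.1 hH 1
  -- The coefficient at 1 shows that the order of the normal closure divides that of `H`.
  have h := congrArg (fun x => x.coeff 1) (card_smul_nr_subgroupSum H hM)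
  simp only [coeff_smul, Finsupp.smul_apply, hn, coeff_subgroupSum, smul_eq_mul,
    Set.indicator_of_mem (Subgroup.one_mem _ : (1 : G) ∈ (Subgroup.normalClosure (H : Set G))),
    Pi.one_apply, mul_one] at h
  refine Subgroup.eq_of_le_of_card_ge Subgroup.le_normalClosure ?_
  have h' : (Nat.card (Subgroup.normalClosure (H : Set G)) : ℤ) * n = Nat.card H := by
    exact_mod_cast h
  exact Nat.le_of_dvd Nat.card_pos (Int.natCast_dvd_natCast.1 ⟨n, h'.symm⟩)

end

/-! ### Nonabelian groups -/

theorem commutator_le_of_maximal {G : Type u} [Group G] [Finite G] {N : Subgroup G}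
    (hN : ∀ M : Subgroup G, M.Normal → N < M → commutator G ≤ M)
    (hI : ∀ x ∈ integralGroupRing G, (nr !![x] : MonoidAlgebra ℚ G) ∈ integralGroupRing G)
    {H : Subgroup G} (hH : N < H) : commutator G ≤ H := by
  have hM := hN _ (Subgroup.normalClosure_normal (s := (H : Set G)))
    (hH.trans_le Subgroup.le_normalClosure)
  rwa [eq_normalClosure_of_nr_mem H hM (hI _ (subgroupSum_mem_integralGroupRing H))]

theorem commutator_quotient_le {G : Type u} [Group G] {N : Subgroup G} [N.Normal]
    (hN : ∀ H : Subgroup G, N < H → commutator G ≤ H) (K : Subgroup (G ⧸ N)) (hK : K ≠ ⊥) :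
    commutator (G ⧸ N) ≤ K := by
  have hlt : N < K.comap (QuotientGroup.mk' N) := by
    refine lt_of_le_of_ne (fun n hn => ?_) fun h => hK ?_
    · rw [Subgroup.mem_comap, QuotientGroup.mk'_apply, (QuotientGroup.eq_one_iff n).2 hn]
      exact K.one_mem
    · rw [eq_bot_iff]
      intro q hq
      obtain ⟨g, rfl⟩ := QuotientGroup.mk'_surjective N q
      have : g ∈ N := h ▸ (Subgroup.mem_comap.2 hq)
      rwa [Subgroup.mem_bot, QuotientGroup.mk'_apply, QuotientGroup.eq_one_iff]
  rw [commutator_def, Subgroup.commutator_le]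
  intro q₁ _ q₂ _
  obtain ⟨g₁, rfl⟩ := QuotientGroup.mk'_surjective N q₁
  obtain ⟨g₂, rfl⟩ := QuotientGroup.mk'_surjective N q₂
  rw [← map_commutatorElement]
  exact hN _ hlt (Subgroup.commutator_mem_commutator (Subgroup.mem_top g₁) (Subgroup.mem_top g₂))

theorem exists_nr_notMem_of_not_comm {G : Type u} [Group G] [Finite G]
    (hne : ¬ ∀ a b : G, a * b = b * a) :
    ∃ x ∈ integralGroupRing G, (nr !![x] : MonoidAlgebra ℚ G) ∉ integralGroupRing G := by
  by_contra! hI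
  obtain ⟨N, ⟨hNn, hNc⟩, hNmax⟩ :=
    (Set.toFinite {N : Subgroup G | N.Normal ∧ ¬ commutator G ≤ N}).exists_maximal
      ⟨⊥, inferInstance, fun h => hne fun a b => commutatorElement_eq_one_iff_mul_comm.1
        (Subgroup.mem_bot.1 (h (Subgroup.commutator_mem_commutator
          (Subgroup.mem_top a) (Subgroup.mem_top b))))⟩
  have hN : ∀ M : Subgroup G, M.Normal → N < M → commutator G ≤ M := fun M hM hlt => by
    by_contra hc
    exact hlt.not_ge (hNmax ⟨hM, hc⟩ hlt.le)
  have hQ := commutator_quotient_le fun H hH => commutator_le_of_maximal hN hI hH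
  obtain ⟨q, hq⟩ := exists_forall_mem_commutator_isConj (Q := G ⧸ N) (fun h => hNc (by
    rw [commutator_def, Subgroup.commutator_le]
    intro a _ b _
    rw [← QuotientGroup.eq_one_iff, ← QuotientGroup.mk'_apply, map_commutatorElement]
    exact commutatorElement_eq_one_iff_mul_comm.2 (h _ _))) hQ
  obtain ⟨g, rfl⟩ := QuotientGroup.mk'_surjective N q
  let M := N ⊔ commutator G
  have hMq : ∀ m ∈ M, (m : G ⧸ N) ∈ commutator (G ⧸ N) := by
    have : M ≤ (commutator (G ⧸ N)).comap (QuotientGroup.mk' N) := by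
      refine sup_le (fun n hn => ?_) ?_
      · rw [Subgroup.mem_comap, QuotientGroup.mk'_apply, (QuotientGroup.eq_one_iff n).2 hn]
        exact Subgroup.one_mem _
      · rw [commutator_def, Subgroup.commutator_le]
        intro a _ b _
        rw [Subgroup.mem_comap, map_commutatorElement]
        exact Subgroup.commutator_mem_commutator (Subgroup.mem_top _) (Subgroup.mem_top _)
    exact fun m hm => this hm
  let x : MonoidAlgebra ℚ G := MonoidAlgebra.single g 1 * subgroupSum N
  let y : MonoidAlgebra ℚ G := nr !![x]
  have hyI : y ∈ integralGroupRing G := hI x (Subring.mul_mem _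
    (single_mem_integralGroupRing g) (subgroupSum_mem_integralGroupRing N))
  have hyN : ∀ n ∈ N, ∀ k, y.coeff (k * n) = y.coeff k := by
    intro n hn k
    have h1 : y * subgroupSum N = (Nat.card N : ℚ) • y := nr_mul_subgroupSum_mul N _
    have h2 : y * MonoidAlgebra.single n⁻¹ 1 = y := by
      apply smul_right_injective _ (card_ne_zero_rat N)
      change (Nat.card N : ℚ) • _ = (Nat.card N : ℚ) • y
      rw [← smul_mul_assoc, ← h1, mul_assoc, subgroupSum_mul_single (N.inv_mem hn)]
    have h3 := congrArg (fun z => z.coeff k) h2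
    simpa using h3
  have hyc : ∀ k h, y.coeff (k * h * k⁻¹) = y.coeff h := by
    intro k h
    have h1 := mem_center_iff_forall_single.1 (nr !![x]).2 k
    have h2 := congrArg (fun z => z.coeff (k * h)) h1
    simpa [mul_assoc] using h2.symm
  -- Modulo `N`, `m * g` is conjugate to `g`; the remaining factor in `N` is absorbed by `hyN`.
  have hyM : ∀ m ∈ M, y.coeff (m * g) = y.coeff g := by
    intro m hm
    obtain ⟨k, hk⟩ := hq _ (hMq m hm)
    obtain ⟨k, rfl⟩ := QuotientGroup.mk'_surjective N k
    have hk' : ((k * g * k⁻¹ : G) : G ⧸ N) = (m * g : G) := hk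
    have h1 := hyN _ (QuotientGroup.eq.1 hk') (k * g * k⁻¹)
    rw [mul_inv_cancel_left, hyc] at h1
    exact h1
  have hxM : subgroupSum M * x = (Nat.card N : ℚ) • (MonoidAlgebra.single g 1 * subgroupSum M) := by
    have h1 : subgroupSum M * subgroupSum N = (Nat.card N : ℚ) • subgroupSum M :=
      mul_subgroupSum_eq_of_forall fun n hn =>
        subgroupSum_mul_single ((le_sup_left : N ≤ M) hn)
    rw [mul_left_comm_of_mem_center (subgroupSum_mem_center M), h1, mul_smul_comm]
  -- Comparing coefficients at `g` gives `|M| * y(g) = |N|`.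
  have hcoef := congrArg (fun z => z.coeff g) ((subgroupSum_mul_nr M le_sup_right x).trans hxM)
  have hl : (subgroupSum M * y).coeff g = Nat.card M * y.coeff g := by
    have := Fintype.ofFinite M
    rw [subgroupSum_eq_sum, Finset.sum_mul, MonoidAlgebra.coeff_sum, Finset.sum_apply',
      Finset.sum_congr rfl fun (m : M) _ => by
        rw [MonoidAlgebra.coeff_single_mul_apply, one_mul, hyM _ (M.inv_mem m.2)]]
    simp
  obtain ⟨n, hn⟩ := mem_integralGroupRing_iff.1 hyI g
  have hr : (Nat.card M : ℚ) * n = Nat.card N := by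
    rw [← hn, ← hl]
    refine hcoef.trans ?_
    simp [coeff_subgroupSum]
  have hr' : (Nat.card M : ℤ) * n = Nat.card N := by exact_mod_cast hr
  have hle := Nat.le_of_dvd Nat.card_pos (Int.natCast_dvd_natCast.1 ⟨n, hr'.symm⟩)
  have heq : N = M := Subgroup.eq_of_le_of_card_ge le_sup_left hle
  exact hNc (heq ▸ le_sup_right)

/-! ### Commutative algebras and the conclusion -/

theorem integralityRing_eq_centreOf_of_comm {A : Type u} [Ring A] [Algebra ℚ A]
    [FiniteDimensional ℚ A] [IsSemisimpleRing A] (hcomm : ∀ a b : A, a * b = b * a)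
    (L : Subring A) : (integralityRing L : Set A) = centreOf L := by
  have hL : ∀ a, a ∈ centreOf L ↔ a ∈ L := fun a =>
    ⟨by rintro ⟨b, _, rfl⟩; exact b.2, fun ha => ⟨⟨a, ha⟩, Subring.mem_center_iff.2 fun b =>
      Subtype.ext (hcomm _ _), rfl⟩⟩
  have hcen : ∀ a : A, a ∈ Subring.center A := fun a => Subring.mem_center_iff.2 fun b => hcomm b a
  refine Set.Subset.antisymm (fun z hz => ?_) fun z hz => ?_
  · induction hz using Submodule.span_induction with
    | mem z hz =>
      obtain ⟨n, H, hH, rfl⟩ := hz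
      let H'' : Matrix (Fin n) (Fin n) (Subring.center A) := fun i j => ⟨H i j, hcen _⟩
      have h1 : nr H = H''.det := nr_eq_det hcomm H''
      let S : Subring (Subring.center A) := L.comap (Subring.center A).subtype
      have h2 : H''.det ∈ S := by
        rw [Matrix.det_apply]
        exact Subring.sum_mem _ fun σ _ => Subring.zsmul_mem _
          (Subring.prod_mem _ fun i _ => hH _ _) _
      rw [SetLike.mem_coe, hL, h1]
      exact h2
    | zero => exact Subring.zero_mem _
    | add a b _ _ ha hb => exact Subring.add_mem _ ha hb
    | smul c a _ ha => exact Subring.mul_mem _ c.2 ha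
  -- The empty matrix has reduced norm 1, so the span contains all scalars.
  · have h1 : (1 : A) ∈ integralityRing L := Submodule.subset_span
      ⟨0, 0, fun i => i.elim0, by
        rw [show nr (0 : Matrix (Fin 0) (Fin 0) A) = Matrix.det 0 from nr_eq_det hcomm 0]; simp⟩
    have h2 := Submodule.smul_mem _ (⟨z, hz⟩ : centreOf L) h1
    rw [Subring.smul_def, smul_eq_mul, mul_one] at h2
    exact h2

theorem mainTheorem9 (G : Type u) [Group G] [Finite G] :
    ((integralityRing (integralGroupRing G) : Set (MonoidAlgebra ℚ G)) =
        (centreOf (integralGroupRing G) : Set (MonoidAlgebra ℚ G)) ↔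
      ∀ a b : G, a * b = b * a) ∧
    ((¬ ∀ a b : G, a * b = b * a) →
      ∃ x ∈ integralGroupRing G,
        (nr !![x] : MonoidAlgebra ℚ G) ∉ integralGroupRing G) := by
  refine ⟨⟨fun h => ?_, fun h => integralityRing_eq_centreOf_of_comm (fun a b => ?_) _⟩,
    exists_nr_notMem_of_not_comm⟩
  · by_contra hne
    obtain ⟨x, hx, hnr⟩ := exists_nr_notMem_of_not_comm hne
    have h1 : (nr !![x] : MonoidAlgebra ℚ G) ∈ centreOf (integralGroupRing G) := by
      rw [← SetLike.mem_coe, ← h]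
      exact Submodule.subset_span ⟨1, !![x], fun i j => by fin_cases i; fin_cases j; exact hx, rfl⟩
    obtain ⟨z, _, hz⟩ := h1
    exact hnr (hz ▸ z.2)
  · let _ : CommGroup G := { (inferInstance : Group G) with mul_comm := h }
    exact mul_comm a b
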